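/- Let $\mathbb N=\{1,2,3,\dots\}$. Let $\mathcal F$ be any one of the following families of subsets $A\subseteq\mathbb N$: 1. the sets containing arbitrarily long arithmetic progressions; 2. the sets satisfying the conclusion of the polynomial van der Waerden theorem, i.e. the sets $A$ such that for every finite set of polynomials $p_1,\dots,p_k\in\mathbb Q[x]$ with $p_i(\mathbb Z)\subseteq\mathbb Z$ and $p_i(0)=0$ there are $a,d\in\mathbb N$ with $a,\,a+p_1(d),\dots,a+p_k(d)\in A$; 3. the piecewise syndetic sets, i.e. the intersections of a syndetic set (one with bounded gaps) and a thick set (one containing arbitrarily long intervals); 4. the sets of positive upper Banach density, where the upper Banach density of $A$ is $\limsup_{n\to\infty}\sup_{k\in\mathbb N}|A\cap[k,k+n)|/n$; 5. the IP-sets, i.e. the sets containing all sums $\sum_{i\in H}a_i$ ($H\subseteq\mathbb N$ finite and nonempty) for some sequence $(a_i)_{i\in\mathbb N}$ in $\mathbb N$; 6. the $\Delta$-sets, i.e. the sets containing $\{s_j-s_i : i,j\in\mathbb N,\ i<j\}$ for some infinite sequence $(s_i)_{i\in\mathbb N}$ in $\mathbb N$; 7. the central sets, i.e. the sets belonging to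 some minimal idempotent ultrafilter of $(\beta\mathbb N,+)$; 8. for a given finite homogeneous system $Mx=0$ of linear equations with rational coefficients in $v\ge 1$ unknowns that is partition regular (for every finite colouring of $\mathbb N$ it has a solution in $\mathbb N^v$ whose entries all have the same colour), the sets $A$ such that $Mx=0$ has infinitely many solutions $x\in A^v$. Consider the random graph on the vertex set $\mathbb N$ in which each possible edge is present independently with probability $\tfrac12$. Then almost surely there is some $A\in\mathcal F$ containing no edges of the graph. In particular, almost surely there is a set $A\in\mathcal F$ that is not weakly universal, i.e. such that some finite graph is not isomorphic to an induced subgraph of the graph induced on $A$. -/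

import Mathlib

open MeasureTheory

/-! Throughout, the set `{1, 2, 3, …}` of natural numbers without `0` is `ℕ+`. -/

section Families

/-- `A` contains arithmetic progressions `a, a + d, …, a + (k - 1) d` (with `d ≥ 1`) of every
length `k`. -/
def HasLongAPs (A : Set ℕ+) : Prop :=
  ∀ k : ℕ, ∃ a d : ℕ+, ∀ i < k, ∃ b ∈ A, (b : ℕ) = a + i * d

/-- A polynomial with rational coefficients that takes integer values on the integers and
vanishes at `0`. -/
def IsIntegralPoly (p : Polynomial ℚ) : Prop :=
  p.eval 0 = 0 ∧ ∀ n : ℤ, ∃ m : ℤ, p.eval (n : ℚ) = m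

/-- `A` satisfies the conclusion of the polynomial van der Waerden theorem: for all integral
polynomials `p₁, …, pₖ` vanishing at `0` there are `a, d ≥ 1` such that
`a, a + p₁(d), …, a + pₖ(d)` all lie in `A`. -/
def IsPolyVanDerWaerden (A : Set ℕ+) : Prop :=
  ∀ P : Finset (Polynomial ℚ), (∀ p ∈ P, IsIntegralPoly p) →
    ∃ a d : ℕ+, a ∈ A ∧ ∀ p ∈ P, ∃ b ∈ A, (b : ℚ) = (a : ℚ) + p.eval (d : ℚ)

/-- `A` contains arbitrarily long intervals. -/
def IsThick (A : Set ℕ+) : Prop :=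
  ∀ n : ℕ+, ∃ k : ℕ+, Set.Ico k (k + n) ⊆ A

/-- `A` has bounded gaps. -/
def IsSyndetic (A : Set ℕ+) : Prop :=
  ∃ n : ℕ+, ∀ k : ℕ+, (A ∩ Set.Ico k (k + n)).Nonempty

/-- `A` is the intersection of a syndetic set and a thick set. -/
def IsPiecewiseSyndetic (A : Set ℕ+) : Prop :=
  ∃ S T : Set ℕ+, IsSyndetic S ∧ IsThick T ∧ A = S ∩ T

/-- The upper Banach density `limsup_n sup_k |A ∩ [k, k + n)| / n`. -/
noncomputable def upperBanachDensity (A : Set ℕ+) : ℝ :=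
  Filter.limsup
    (fun n : ℕ+ => ⨆ k : ℕ+, ((A ∩ Set.Ico k (k + n)).ncard : ℝ) / ((n : ℕ) : ℝ)) Filter.atTop

/-- `A` contains all sums of finitely many (at least one) distinct terms of some infinite
sequence in `ℕ+`. -/
def IsIPSet (A : Set ℕ+) : Prop :=
  ∃ a : Stream' ℕ+, Hindman.FS a ⊆ A

/-- `A` contains `s j - s i` for all `i < j`, for some infinite sequence `s`. The difference has
to be an element of `ℕ+`, so `s` is strictly increasing. -/
def IsDeltaSet (A : Set ℕ+) : Prop :=
  ∃ s : ℕ → ℕ+, ∀ i j : ℕ, i < j → ∃ b ∈ A, s j = s i + b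

attribute [local instance] Ultrafilter.addSemigroup

/-- `p` is an idempotent of the semigroup `(βℕ+, +)` of ultrafilters, and it is minimal for the
usual order of idempotents, in which `q ≤ p` means `p + q = q = q + p`. -/
def IsMinimalIdempotent (p : Ultrafilter ℕ+) : Prop :=
  p + p = p ∧ ∀ q : Ultrafilter ℕ+, q + q = q → p + q = q → q + p = q → q = p

/-- `A` belongs to some minimal idempotent ultrafilter. -/
def IsCentral (A : Set ℕ+) : Prop :=
  ∃ p : Ultrafilter ℕ+, IsMinimalIdempotent p ∧ A ∈ p

/-- The solutions in `A` of the homogeneous system of linear equations `M x = 0`. -/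
def solutionsIn {u v : ℕ} (M : Matrix (Fin u) (Fin v) ℚ) (A : Set ℕ+) : Set (Fin v → ℕ+) :=
  {x | M.mulVec (fun j => ((x j : ℕ) : ℚ)) = 0 ∧ ∀ j, x j ∈ A}

/-- For every finite colouring of `ℕ+`, the system `M x = 0` has a monochromatic solution. -/
def IsPartitionRegularSystem {u v : ℕ} (M : Matrix (Fin u) (Fin v) ℚ) : Prop :=
  ∀ (r : ℕ) (c : ℕ+ → Fin r), ∃ i : Fin r, (solutionsIn M (c ⁻¹' {i})).Nonempty

end Families

/-- In the graph `G`, the set `A` contains a copy of every finite graph as an induced subgraph. -/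
def IsWeaklyUniversal (G : SimpleGraph ℕ+) (A : Set ℕ+) : Prop :=
  ∀ (n : ℕ) (H : SimpleGraph (Fin n)), H.IsIndContained (G.induce A)

/-- The law of the random graph on `ℕ+` in which every possible edge is present independently with
probability `1 / 2`. -/
noncomputable def randomGraph : Measure (SimpleGraph ℕ+) :=
  SimpleGraph.binomialRandom ℕ+ ⟨1 / 2, by norm_num, by norm_num⟩

/-! Fix a finite set `S` and infinitely many disjoint far-away blocks of bounded size. The events
"no edge inside the block or from it to `S`" depend on disjoint sets of pairs and have probability
bounded below, so by Borel–Cantelli one of them almost surely occurs. There are only countably many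
`S`, so almost surely an independent set can be built greedily, adjoining one block of each of
countably many types (`ae_binomialRandom_exists_independent`).

With intervals of every length as blocks, the result is a thick independent set, and every thick set
lies in each of the first seven families; the deepest case is centrality (`IsThick.isCentral`),
which yields IP and Δ. For a homogeneous system the blocks are the dilates of a single solution. -/

open ProbabilityTheory unitInterval

/-! ### Independent sets in the random graph -/

section IndependentSets

/-- Second Borel–Cantelli lemma for a product of Bernoulli laws: infinitely many pairwise disjoint
finite sets of coordinates of bounded size are not all met. -/
lemma ae_infinitePi_exists_forall_not {ι : Type*} (μ : ι → Measure Prop)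
    [∀ i, IsProbabilityMeasure (μ i)] {q : ENNReal} (hq0 : q ≠ 0) (hq1 : q ≤ 1)
    (hq : ∀ i, q ≤ μ i {False}) (E : ℕ → Finset ι) (hE : Pairwise fun m n => Disjoint (E m) (E n))
    (c : ℕ) (hc : ∀ n, (E n).card ≤ c) :
    ∀ᵐ ω ∂Measure.infinitePi μ, ∃ n, ∀ e ∈ E n, ¬ ω e := by
  classical
  let s (n : ℕ) : Set (ι → Prop) := Set.pi (E n) fun _ => {False}
  have hsm (n : ℕ) : MeasurableSet (s n) :=
    MeasurableSet.pi (E n).countable_toSet fun _ _ => MeasurableSet.of_discrete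
  have hμ (F : Finset ι) :
      Measure.infinitePi μ (Set.pi F fun _ => {False}) = ∏ e ∈ F, μ e {False} :=
    Measure.infinitePi_pi μ fun _ _ => MeasurableSet.of_discrete
  have hind : iIndepSet s (Measure.infinitePi μ) := by
    rw [iIndepSet_iff_meas_biInter hsm]
    intro T
    have : ⋂ i ∈ T, s i = Set.pi (T.biUnion E) fun _ => {False} := by
      ext ω
      simp only [s, Set.mem_iInter, Set.mem_pi, Finset.mem_coe, Finset.mem_biUnion]
      grind
    rw [this, hμ, Finset.prod_biUnion fun i _ j _ hij => hE hij]
    exact Finset.prod_congr rfl fun i _ => (hμ _).symm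
  have hle (n : ℕ) : q ^ c ≤ Measure.infinitePi μ (s n) := by
    rw [hμ]
    calc q ^ c ≤ q ^ (E n).card := pow_le_pow_right_of_le_one' hq1 (hc n)
      _ ≤ _ := by
        rw [← Finset.prod_const]
        exact Finset.prod_le_prod' fun e _ => hq e
  have htop : ∑' n, Measure.infinitePi μ (s n) = ⊤ := by
    refine top_unique ?_
    rw [← ENNReal.tsum_const_eq_top_of_ne_zero (α := ℕ) (pow_ne_zero c hq0)]
    exact ENNReal.tsum_le_tsum hle
  have hlim := measure_limsup_eq_one hsm hind htop
  rw [← prob_compl_eq_zero_iff (MeasurableSet.measurableSet_limsup hsm)] at hlim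
  refine measure_mono_null ?_ hlim
  intro ω hω hω'
  obtain ⟨n, hn⟩ := (Filter.mem_limsup_iff_frequently_mem.1 hω').exists
  refine hω ⟨n, fun e he h => ?_⟩
  have := hn e he
  simp [h] at this

variable {V : Type*} [Countable V] {p : I}

lemma ae_binomialRandom_exists_forall_notMem_edgeSet (hp : p < 1) (E : ℕ → Finset (Sym2 V))
    (hE : Pairwise fun m n => Disjoint (E m) (E n)) (c : ℕ) (hc : ∀ n, (E n).card ≤ c) :
    ∀ᵐ G ∂SimpleGraph.binomialRandom V p, ∃ n, ∀ e ∈ E n, e ∉ G.edgeSet := by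
  rw [ae_iff, SimpleGraph.binomialRandom_apply]
  have hσ : (toNNReal (σ p) : ENNReal) ≠ 0 := by
    have : (0 : ℝ) < 1 - p := sub_pos.2 hp
    exact ENNReal.coe_ne_zero.2 fun h => this.ne' (congrArg NNReal.toReal h)
  -- The bound `σ p` on the mass of `False` holds for loops too: on the diagonal all the mass sits
  -- at `False`. So the sets `E n` may contain diagonal pairs.
  have h := ae_infinitePi_exists_forall_not
    (fun e : Sym2 V ↦ toNNReal p • .dirac (¬ e.IsDiag) + toNNReal (σ p) • .dirac False)
    (q := toNNReal (σ p)) hσ (by exact_mod_cast (σ p).2.2) (fun e => by simp) E hE c hc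
  refine measure_mono_null ?_ h
  rintro _ ⟨G, hG, rfl⟩
  exact hG

/-- Almost surely, one of the sets of a family that contains sets of bounded size arbitrarily far
out is independent and not joined to the given finite set. -/
lemma ae_binomialRandom_exists_not_adj [DecidableEq V] (hp : p < 1) (𝓑 : Set (Finset V)) (c : ℕ)
    (h𝓑 : ∀ K : Finset V, ∃ B ∈ 𝓑, Disjoint B K ∧ B.card ≤ c) (S : Finset V) :
    ∀ᵐ G ∂SimpleGraph.binomialRandom V p,
      ∃ B ∈ 𝓑, ∀ b ∈ B, ∀ a ∈ S ∪ B, ¬ G.Adj b a := by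
  choose f hf𝓑 hfd hfc using h𝓑
  -- Each block `f (U n)` avoids `S` and all earlier blocks. Hence a pair in `E n` has an endpoint
  -- outside `U n`, whereas pairs in earlier `E m` lie within `U n`.
  let U (n : ℕ) : Finset V := (fun K => K ∪ f K)^[n] S
  have hU (n : ℕ) : U (n + 1) = U n ∪ f (U n) := Function.iterate_succ_apply' _ n S
  have hmono : Monotone U := monotone_nat_of_le_succ fun n => by
    rw [hU]; exact Finset.subset_union_left
  have hdis {m n : ℕ} (hmn : m < n) : Disjoint (f (U m)) (f (U n)) := by
    refine ((hfd (U n)).mono_right (?_ : f (U m) ≤ U n)).symm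
    exact le_trans (by rw [hU]; exact Finset.subset_union_right) (hmono hmn)
  let E (n : ℕ) : Finset (Sym2 V) :=
    (f (U n) ×ˢ (S ∪ f (U n))).image fun x => s(x.1, x.2)
  have hE (m n : ℕ) (hmn : m < n) : Disjoint (E m) (E n) := by
    rw [Finset.disjoint_left]
    intro e hm hn
    simp only [E, Finset.mem_image, Finset.mem_product, Prod.exists, Finset.mem_union] at hm hn
    obtain ⟨a, b, ⟨ha, hb⟩, rfl⟩ := hm
    obtain ⟨a', b', ⟨ha', hb'⟩, he⟩ := hn
    have h₁ := Finset.disjoint_left.1 (hdis hmn)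
    have h₂ := Finset.disjoint_right.1 (hfd (U n))
    have h₃ : S ⊆ U n := hmono n.zero_le
    rcases Sym2.eq_iff.1 he with ⟨rfl, rfl⟩ | ⟨rfl, rfl⟩
    · exact h₁ ha ha'
    · rcases hb with hb | hb
      · exact h₂ (h₃ hb) ha'
      · exact h₁ hb ha'
  have hcard (n : ℕ) : (E n).card ≤ c * (S.card + c) := by
    refine Finset.card_image_le.trans ?_
    rw [Finset.card_product]
    have := hfc (U n)
    exact Nat.mul_le_mul this ((Finset.card_union_le _ _).trans (by lia))
  filter_upwards [ae_binomialRandom_exists_forall_notMem_edgeSet hp E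
    (fun m n hmn => hmn.lt_or_gt.elim (hE m n) fun h => (hE n m h).symm) _ hcard] with G ⟨n, hn⟩
  refine ⟨f (U n), hf𝓑 _, fun b hb a ha hba => hn s(b, a) ?_ hba⟩
  exact Finset.mem_image.2 ⟨(b, a), Finset.mem_product.2 ⟨hb, ha⟩, rfl⟩

/-- Given countably many families, each containing sets of bounded size arbitrarily far out, almost
surely some independent set contains a member of each of them. -/
theorem ae_binomialRandom_exists_independent (hp : p < 1) (𝓑 : ℕ → Set (Finset V)) (c : ℕ → ℕ)
    (h𝓑 : ∀ n, ∀ K : Finset V, ∃ B ∈ 𝓑 n, Disjoint B K ∧ B.card ≤ c n) :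
    ∀ᵐ G ∂SimpleGraph.binomialRandom V p, ∃ A : Set V,
      (∀ a ∈ A, ∀ b ∈ A, ¬ G.Adj a b) ∧ ∀ n, ∃ B ∈ 𝓑 n, (B : Set V) ⊆ A := by
  classical
  -- The finite sets met by the greedy construction depend on `G`, so the almost sure event has to
  -- cover all `S` at once.
  have h : ∀ᵐ G ∂SimpleGraph.binomialRandom V p, ∀ n, ∀ S : Finset V,
      ∃ B ∈ 𝓑 n, ∀ b ∈ B, ∀ a ∈ S ∪ B, ¬ G.Adj b a :=
    ae_all_iff.2 fun n => ae_all_iff.2 fun S =>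
      ae_binomialRandom_exists_not_adj hp (𝓑 n) (c n) (h𝓑 n) S
  filter_upwards [h] with G hG
  choose f hf𝓑 hf using hG
  let U : ℕ → Finset V := fun n => Nat.rec ∅ (fun n S => S ∪ f n S) n
  have hU (n : ℕ) : U (n + 1) = U n ∪ f n (U n) := rfl
  have hmono : Monotone U := monotone_nat_of_le_succ fun n => by
    rw [hU]; exact Finset.subset_union_left
  have hind (n : ℕ) : ∀ a ∈ U n, ∀ b ∈ U n, ¬ G.Adj a b := by
    induction n with
    | zero => simp [U]
    | succ n ih =>
      intro a ha b hb hab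
      rw [hU] at ha hb
      rcases Finset.mem_union.1 ha with ha' | ha'
      · rcases Finset.mem_union.1 hb with hb' | hb'
        · exact ih a ha' b hb' hab
        · exact hf n (U n) b hb' a ha hab.symm
      · exact hf n (U n) a ha' b hb hab
  refine ⟨⋃ n, {x | x ∈ U n}, ?_, fun n => ⟨f n (U n), hf𝓑 _ _, fun x hx => ?_⟩⟩
  · intro a ha b hb
    obtain ⟨m, hm⟩ := Set.mem_iUnion.1 ha
    obtain ⟨n, hn⟩ := Set.mem_iUnion.1 hb
    exact hind (max m n) a (hmono (le_max_left m n) hm) b (hmono (le_max_right m n) hn)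
  · exact Set.mem_iUnion.2 ⟨n + 1, by rw [hU]; exact Finset.mem_union_right _ hx⟩

theorem ae_randomGraph_exists_isThick_independent :
    ∀ᵐ G ∂randomGraph, ∃ A : Set ℕ+, (∀ a ∈ A, ∀ b ∈ A, ¬ G.Adj a b) ∧ IsThick A := by
  have h := ae_binomialRandom_exists_independent
    (p := ⟨1 / 2, by norm_num, by norm_num⟩) (Subtype.mk_lt_mk.2 (by norm_num))
    (fun n => Set.range fun k : ℕ+ => Finset.Ico k (k + n.succPNat)) (fun n => n + 1) (by
      intro n K
      refine ⟨_, ⟨K.sup id + 1, rfl⟩, ?_, ?_⟩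
      · rw [Finset.disjoint_right]
        intro a ha ha'
        have h₁ : a ≤ K.sup id := Finset.le_sup (f := id) ha
        exact absurd ((Finset.mem_Ico.1 ha').1.trans h₁) (PNat.lt_add_right _ _).not_ge
      · simp [PNat.card_Ico])
  filter_upwards [h] with G ⟨A, hA, hB⟩
  refine ⟨A, hA, fun n => ?_⟩
  obtain ⟨_, ⟨k, rfl⟩, hk⟩ := hB (n - 1 : ℕ)
  refine ⟨k, ?_⟩
  have hn : ((n : ℕ) - 1).succPNat = n := PNat.succPNat_natPred n
  simpa [hn] using hk

/-- By homogeneity every dilate `t * x` of one solution `x` is a solution; its entries form a block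
of at most `v` elements, which moves past any finite set as `t` grows. -/
theorem ae_randomGraph_exists_infinite_solutionsIn_independent {u v : ℕ} (hv : 0 < v)
    (M : Matrix (Fin u) (Fin v) ℚ) {A₀ : Set ℕ+} (hM : (solutionsIn M A₀).Nonempty) :
    ∀ᵐ G ∂randomGraph, ∃ A : Set ℕ+,
      (∀ a ∈ A, ∀ b ∈ A, ¬ G.Adj a b) ∧ (solutionsIn M A).Infinite := by
  obtain ⟨x, hx, -⟩ := hM
  have h := ae_binomialRandom_exists_independent
    (p := ⟨1 / 2, by norm_num, by norm_num⟩) (Subtype.mk_lt_mk.2 (by norm_num))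
    (fun n => (fun t : ℕ+ => Finset.univ.image fun j => t * x j) '' {t | n < (t : ℕ)})
    (fun _ => v) (by
      intro n K
      refine ⟨_, ⟨n.succPNat + K.sup id, ?_, rfl⟩, ?_, ?_⟩
      · simp only [Set.mem_ofPred_eq, PNat.add_coe, Nat.succPNat_coe]
        lia
      · rw [Finset.disjoint_right]
        intro a ha ha'
        have h₁ : a ≤ K.sup id := Finset.le_sup (f := id) ha
        obtain ⟨j, -, rfl⟩ := Finset.mem_image.1 ha'
        refine absurd h₁ (lt_of_lt_of_le (PNat.lt_add_left _ _) (le_mul_of_one_le_right' ?_)).not_ge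
        exact one_le
      · exact Finset.card_image_le.trans (by simp))
  filter_upwards [h] with G ⟨A, hA, hB⟩
  refine ⟨A, hA, fun hfin => ?_⟩
  -- The type with index `C` only has dilates by `t > C`, whose first entry is at least `t`.
  obtain ⟨C, hC⟩ := (hfin.image fun y => y ⟨0, hv⟩).bddAbove
  obtain ⟨_, ⟨t, ht, rfl⟩, htA⟩ := hB C
  have hmem : (fun j => t * x j) ∈ solutionsIn M A := by
    refine ⟨?_, fun j => htA (by simp)⟩
    have : (fun j => (((t * x j : ℕ+) : ℕ) : ℚ)) = (t : ℚ) • fun j => ((x j : ℕ) : ℚ) := by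
      ext j; simp
    rw [this, Matrix.mulVec_smul, hx, smul_zero]
  have h₁ : t * x ⟨0, hv⟩ ≤ C := hC ⟨_, hmem, rfl⟩
  have h₂ : t ≤ t * x ⟨0, hv⟩ := le_mul_of_one_le_right' one_le
  exact absurd (h₂.trans h₁) (not_le.2 ht)

end IndependentSets

/-! ### Thick sets belong to the first seven families -/

section Thick

variable {A : Set ℕ+}

/-- Two-sided form of thickness: a centre with room `n` on both sides, as needed for polynomials
with negative values. -/
lemma IsThick.exists_forall_le_mem (hA : IsThick A) (n : ℕ) :
    ∃ k : ℕ+, n < (k : ℕ) ∧ ∀ m : ℕ+, (k : ℕ) ≤ m + n → (m : ℕ) ≤ k + n → m ∈ A := by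
  obtain ⟨k, hk⟩ := hA (n.succPNat + n.succPNat + n.succPNat)
  refine ⟨k + n.succPNat, ?_, fun m h₁ h₂ => hk ⟨?_, ?_⟩⟩
  · simp only [PNat.add_coe, Nat.succPNat_coe]; lia
  · rw [← PNat.coe_le_coe]
    simp only [PNat.add_coe, Nat.succPNat_coe] at *; lia
  · rw [← PNat.coe_lt_coe]
    simp only [PNat.add_coe, Nat.succPNat_coe] at *; lia

lemma IsThick.hasLongAPs (hA : IsThick A) : HasLongAPs A := by
  intro k
  obtain ⟨a, -, ha⟩ := hA.exists_forall_le_mem k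
  refine ⟨a, 1, fun i hi => ⟨⟨a + i, by positivity⟩, ha _ ?_ ?_, by simp⟩⟩ <;>
    simp only [PNat.mk_coe] <;> lia

/-- The step `d = 1` suffices: the finitely many integers `p(1)` are bounded, so a centre with
enough room works. -/
lemma IsThick.isPolyVanDerWaerden (hA : IsThick A) : IsPolyVanDerWaerden A := by
  intro P hP
  have hP' (p : Polynomial ℚ) : ∃ m : ℤ, p ∈ P → p.eval 1 = m := by
    by_cases hp : p ∈ P
    · obtain ⟨m, hm⟩ := (hP p hp).2 1
      exact ⟨m, fun _ => by simpa using hm⟩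
    · exact ⟨0, fun h => absurd h hp⟩
  choose m hm using hP'
  obtain ⟨a, hna, ha⟩ := hA.exists_forall_le_mem (P.sup fun p => (m p).natAbs)
  refine ⟨a, 1, ha a (by lia) (by lia), fun p hp => ?_⟩
  have hle : (m p).natAbs ≤ P.sup fun p => (m p).natAbs :=
    Finset.le_sup (f := fun p => (m p).natAbs) hp
  obtain ⟨b, hb⟩ : ∃ b : ℕ, (b : ℤ) = a + m p := ⟨((a : ℤ) + m p).toNat, by lia⟩
  refine ⟨⟨b, by lia⟩, ha _ ?_ ?_, ?_⟩
  · simp only [PNat.mk_coe]; lia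
  · simp only [PNat.mk_coe]; lia
  · have : (b : ℚ) = a + m p := by exact_mod_cast hb
    simpa [hm p hp] using this

lemma IsThick.isPiecewiseSyndetic (hA : IsThick A) : IsPiecewiseSyndetic A := by
  refine ⟨Set.univ, A, ⟨1, fun k => ⟨k, trivial, le_rfl, PNat.lt_add_right _ _⟩⟩, hA, ?_⟩
  rw [Set.univ_inter]

lemma IsThick.upperBanachDensity_eq_one (hA : IsThick A) : upperBanachDensity A = 1 := by
  have hcard (n k : ℕ+) : (Set.Ico k (k + n)).ncard = n := by
    rw [← Finset.coe_Ico, Set.ncard_coe_finset, PNat.card_Ico]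
    simp
  have hle (n k : ℕ+) : ((A ∩ Set.Ico k (k + n)).ncard : ℝ) / ((n : ℕ) : ℝ) ≤ 1 := by
    refine div_le_one_of_le₀ ?_ (Nat.cast_nonneg _)
    exact_mod_cast (Set.ncard_le_ncard Set.inter_subset_right (Set.finite_Ico _ _)).trans
      (hcard n k).le
  have hsup (n : ℕ+) : ⨆ k : ℕ+, ((A ∩ Set.Ico k (k + n)).ncard : ℝ) / ((n : ℕ) : ℝ) = 1 := by
    refine le_antisymm (ciSup_le (hle n)) ?_
    obtain ⟨k, hk⟩ := hA n
    refine le_trans (le_of_eq ?_) (le_ciSup ⟨1, Set.forall_mem_range.2 (hle n)⟩ k)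
    rw [Set.inter_eq_right.2 hk, hcard, div_self]
    exact_mod_cast n.ne_zero
  simp only [upperBanachDensity, hsup, Filter.limsup_const]

attribute [local instance] Ultrafilter.addSemigroup

/-- Every closed left ideal of the semigroup of ultrafilters contains a minimal idempotent. -/
lemma exists_isMinimalIdempotent_mem {L : Set (Ultrafilter ℕ+)} (hne : L.Nonempty)
    (hcl : IsClosed L) (hL : ∀ u, ∀ q ∈ L, u + q ∈ L) : ∃ p ∈ L, IsMinimalIdempotent p := by
  let 𝓛 : Set (Set (Ultrafilter ℕ+)) :=
    {N | N.Nonempty ∧ IsClosed N ∧ ∀ u, ∀ q ∈ N, u + q ∈ N}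
  obtain ⟨N, hNL, hN⟩ : ∃ N ⊆ L, Minimal (· ∈ 𝓛) N := by
    refine zorn_superset_nonempty 𝓛 (fun C hC hchain hCne => ?_) L ⟨hne, hcl, hL⟩
    refine ⟨⋂₀ C, ⟨?_, isClosed_sInter fun N hN => (hC hN).2.1, ?_⟩,
      fun N hN => Set.sInter_subset_of_mem hN⟩
    · have : Nonempty C := hCne.to_subtype
      have hdir : DirectedOn (· ⊇ ·) C := fun s hs t ht => (hchain.total hs ht).elim
        (fun h => ⟨s, hs, subset_rfl, h⟩) fun h => ⟨t, ht, h, subset_rfl⟩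
      exact IsCompact.nonempty_sInter_of_directed_nonempty_isCompact_isClosed hdir (fun N hN => (hC hN).1) (fun N hN => (hC hN).2.1.isCompact)
        fun N hN => (hC hN).2.1
    · exact fun u q hq N hN => (hC hN).2.2 u q (hq N hN)
  obtain ⟨hNne, hNcl, hNideal⟩ := hN.prop
  obtain ⟨p, hp, hpp⟩ := exists_idempotent_in_compact_add_subsemigroup
    Ultrafilter.continuous_add_left N hNne hNcl.isCompact fun u _ q hq => hNideal u q hq
  refine ⟨p, hNL hp, hpp, fun q hqq hpq hqp => ?_⟩
  have hq : q ∈ N := hqp ▸ hNideal q p hp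
  -- The closed left ideal `βℕ+ + q` lies in `N`, so by minimality it contains `p`. Writing `p = u +
  -- q` gives `p + q = u + q + q = p`, while `p + q = q`.
  have hrange : Set.range (· + q) ∈ 𝓛 := by
    refine ⟨⟨_, q, rfl⟩, (isCompact_range (Ultrafilter.continuous_add_left q)).isClosed, ?_⟩
    rintro u _ ⟨w, rfl⟩
    exact ⟨u + w, add_assoc u w q⟩
  obtain ⟨u, rfl⟩ : p ∈ Set.range (· + q) :=
    hN.le_of_le hrange (Set.range_subset_iff.2 fun u => hNideal u q hq) hp
  simp only [add_assoc, hqq] at hpq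
  exact hpq.symm

/-- The ultrafilters containing every translate `A - n` form a closed left ideal. It is nonempty
because the centres of ever longer intervals of `A` eventually lie in each `A - n`. -/
lemma IsThick.isCentral (hA : IsThick A) : IsCentral A := by
  choose k _ hk using hA.exists_forall_le_mem
  let L : Set (Ultrafilter ℕ+) := {q | ∀ n : ℕ+, {m | n + m ∈ A} ∈ q}
  have hcl : IsClosed L := by
    simp only [L, Set.ofPred_forall]
    exact isClosed_iInter fun n => ultrafilter_isClosed_basic _
  have hne : L.Nonempty := by
    refine ⟨Ultrafilter.of (Filter.map k Filter.atTop), fun n => Ultrafilter.of_le _ ?_⟩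
    rw [Filter.mem_map]
    filter_upwards [Filter.eventually_ge_atTop (n : ℕ)] with N hN
    refine hk N _ ?_ ?_ <;> simp only [PNat.add_coe] <;> lia
  have hideal (u : Ultrafilter ℕ+) (q) (hq : q ∈ L) : u + q ∈ L := by
    refine fun n => (Ultrafilter.eventually_add u q fun m => n + m ∈ A).2 (.of_forall fun x => ?_)
    filter_upwards [hq (n + x)] with m hm
    rwa [← add_assoc]
  obtain ⟨p, hp, hmin⟩ := exists_isMinimalIdempotent_mem hne hcl hideal
  refine ⟨p, hmin, ?_⟩
  -- Membership in `L` involves only shifts `n ≥ 1`, so `A ∈ p` is obtained from `p = p + p`: every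
  -- `A - x` lies in `p`.
  rw [← hmin.1]
  exact (Ultrafilter.eventually_add p p fun m => m ∈ A).2 (.of_forall fun x => hp x)

lemma IsCentral.isIPSet (hA : IsCentral A) : IsIPSet A := by
  obtain ⟨p, hp, hpA⟩ := hA
  exact Hindman.exists_FS_of_large p hp.1 A hpA

/-- Differences of partial sums are sums of consecutive terms. The partial sums start at `1`, as `0`
is not in `ℕ+`; the shift cancels. -/
lemma IsIPSet.isDeltaSet (hA : IsIPSet A) : IsDeltaSet A := by
  obtain ⟨a, ha⟩ := hA
  let s : ℕ → ℕ+ := fun n => Nat.rec 1 (fun n t => t + a.get n) n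
  have hs (n : ℕ) : s (n + 1) = s n + a.get n := rfl
  have h (d : ℕ) : ∀ i, ∃ b ∈ Hindman.FS (a.drop i), s (i + d + 1) = s i + b := by
    induction d with
    | zero => exact fun i => ⟨a.get i, a.head_drop i ▸ Hindman.FS.head (a.drop i), hs i⟩
    | succ d ih =>
      intro i
      obtain ⟨b, hb, hsb⟩ := ih (i + 1)
      refine ⟨a.get i + b, a.head_drop i ▸ Hindman.FS.cons (a.drop i) b ?_, ?_⟩
      · rwa [Stream'.tail_eq_drop, Stream'.drop_drop]
      · rw [← add_assoc (s i), ← hs, ← hsb]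
        lia
  refine ⟨s, fun i j hij => ?_⟩
  obtain ⟨d, rfl⟩ := Nat.exists_eq_add_of_lt hij
  obtain ⟨b, hb, hsb⟩ := h d i
  exact ⟨b, ha (Hindman.FS_iter_tail_sub_FS a i hb), hsb⟩

end Thick

/-! ### Failure of weak universality and the final theorem -/

lemma not_isWeaklyUniversal_of_independent {G : SimpleGraph ℕ+} {A : Set ℕ+}
    (hA : ∀ a ∈ A, ∀ b ∈ A, ¬ G.Adj a b) : ¬ IsWeaklyUniversal G A := by
  intro h
  -- A single edge is already a missing induced subgraph.
  obtain ⟨f⟩ := h 2 ⊤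
  have : (G.induce A).Adj (f 0) (f 1) := f.map_rel_iff.2 (by simp)
  exact hA _ (f 0).2 _ (f 1).2 this

theorem mainTheorem5 (F : Set (Set ℕ+))
    (hF : F = {A | HasLongAPs A} ∨
      F = {A | IsPolyVanDerWaerden A} ∨
      F = {A | IsPiecewiseSyndetic A} ∨
      F = {A | 0 < upperBanachDensity A} ∨
      F = {A | IsIPSet A} ∨
      F = {A | IsDeltaSet A} ∨
      F = {A | IsCentral A} ∨
      ∃ (u v : ℕ) (M : Matrix (Fin u) (Fin v) ℚ), 0 < v ∧ IsPartitionRegularSystem M ∧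
        F = {A | (solutionsIn M A).Infinite}) :
    ∀ᵐ G ∂randomGraph,
      (∃ A ∈ F, ∀ a ∈ A, ∀ b ∈ A, ¬ G.Adj a b) ∧ (∃ A ∈ F, ¬ IsWeaklyUniversal G A) := by
  suffices h : ∀ᵐ G ∂randomGraph, ∃ A ∈ F, ∀ a ∈ A, ∀ b ∈ A, ¬ G.Adj a b by
    filter_upwards [h] with G ⟨A, hAF, hA⟩
    exact ⟨⟨A, hAF, hA⟩, A, hAF, not_isWeaklyUniversal_of_independent hA⟩
  have hthick (h : ∀ A, IsThick A → A ∈ F) :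
      ∀ᵐ G ∂randomGraph, ∃ A ∈ F, ∀ a ∈ A, ∀ b ∈ A, ¬ G.Adj a b := by
    filter_upwards [ae_randomGraph_exists_isThick_independent] with G ⟨A, hA, hAt⟩
    exact ⟨A, h A hAt, hA⟩
  rcases hF with rfl | rfl | rfl | rfl | rfl | rfl | rfl | ⟨u, v, M, hv, hM, rfl⟩
  · exact hthick fun A hA => hA.hasLongAPs
  · exact hthick fun A hA => hA.isPolyVanDerWaerden
  · exact hthick fun A hA => hA.isPiecewiseSyndetic
  · exact hthick fun A hA => by simp [hA.upperBanachDensity_eq_one]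
  · exact hthick fun A hA => hA.isCentral.isIPSet
  · exact hthick fun A hA => hA.isCentral.isIPSet.isDeltaSet
  · exact hthick fun A hA => hA.isCentral
  -- One colour is enough: partition regularity serves only to provide some solution in `ℕ+`.
  · obtain ⟨i, hi⟩ := hM 1 fun _ => 0
    filter_upwards [ae_randomGraph_exists_infinite_solutionsIn_independent hv M hi]
      with G ⟨A, hA, hAinf⟩
    exact ⟨A, hAinf, hA⟩
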